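/- Let $\mathcal{L}^-=\{0,1,\circ\}$ with constant symbols $0,1$ and a binary function symbol $\circ$ (written as juxtaposition), and let $\mathcal{L}=\{0,1,\circ,\preceq\}$, where $\preceq$ is a binary relation symbol. For a nonempty binary string $\alpha$ let $\overline{\alpha}$ be the closed term given by $\overline{\mathbf 0}=0$, $\overline{\mathbf 1}=1$, $\overline{\alpha\mathbf 0}=(\overline{\alpha}\circ 0)$, $\overline{\alpha\mathbf 1}=(\overline{\alpha}\circ 1)$, and let $\mathrm{Pref}(\alpha)$ and $\mathrm{Sub}(\alpha)$ be the sets of nonempty prefixes and of nonempty substrings of $\alpha$. Write $x\sqsubseteq_{\mathsf s}y$ for $x=y\vee\exists u v\,[\,y=ux\vee y=xv\vee y=uxv\,]$. $\mathsf{ID}$ is the $\mathcal{L}$-theory with the axioms 1. $\forall xyz\,[(xy)z=x(yz)]$, 2. $\forall xy\,[x\neq y\to(x0\neq y0\wedge x1\neq y1)]$, 3. $\forall xy\,[x0\neq y1]$, 4. $\forall x\,[x\preceq\overline{\alpha}\leftrightarrow\bigvee_{\gamma\in\mathrm{Pref}(\alpha)}x=\overline{\gamma}]$ for each nonempty binary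 string $\alpha$. $\mathsf{ID}^*$ is the $\mathcal{L}^-$-theory with the axioms 1, 2, 3 and $\forall x\,[x\sqsubseteq_{\mathsf s}\overline{\alpha}\to\bigvee_{\gamma\in\mathrm{Sub}(\alpha)}x=\overline{\gamma}]$ for each nonempty binary string $\alpha$. $\overline{\mathsf{ID}}$ and $\overline{\mathsf{ID}}^*$ are $\mathsf{ID}$ and $\mathsf{ID}^*$, respectively, extended with the two axioms $$\forall xy\,[x\neq y\to(0x\neq 0y\wedge 1x\neq 1y)],\qquad \forall xy\,[0x\neq 1y].$$ A relative translation $\tau$ (many-dimensional, parameter-free, one-piece) from a language $\mathcal{L}_1$ to a language $\mathcal{L}_2$ consists of a dimension $m\geq 1$, an $\mathcal{L}_2$-formula $\delta(\vec x)$ for the domain, an $\mathcal{L}_2$-formula $\psi_R(\vec x_1,\dots,\vec x_n)$ for each $n$-ary relation symbol $R$ (including equality), and an $\mathcal{L}_2$-formula $\psi_f(\vec x_1,\dots,\vec x_n,\vec y)$ for each $n$-ary function symbol $f$ (including constants), where all the vectors are $m$-tuples of variables; it extends to all formulas by unnesting terms, commuting with the connectives, and relativizing the quantifiers to $\delta$.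 It is an interpretation of $S$ in $T$ if $T$ proves $\exists\vec x\,\delta(\vec x)$, proves $\bigwedge_i\delta(\vec x_i)\to\exists!\vec y\,[\delta(\vec y)\wedge\psi_f(\vec x_1,\dots,\vec x_n,\vec y)]$ for each function or constant symbol $f$, and proves $\phi^\tau$ for each axiom $\phi$ of $S$ and each equality axiom $\phi$. (A theory proves a formula iff the formula holds in all its models, by completeness.) Two theories are mutually interpretable if each has an interpretation in the other. **Theorem.** $\overline{\mathsf{ID}}$ and $\overline{\mathsf{ID}}^*$ are mutually interpretable. Moreover, the same interpretations work as for $\mathsf{ID}$ and $\mathsf{ID}^*$: there is one relative translation that is both an interpretation of $\mathsf{ID}^*$ in $\mathsf{ID}$ and of $\overline{\mathsf{ID}}^*$ in $\overline{\mathsf{ID}}$, and there is one relative translation that is both an interpretation of $\mathsf{ID}$ in $\mathsf{ID}^*$ and of $\overline{\mathsf{ID}}$ in $\overline{\mathsf{ID}}^*$. -/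

import Mathlib

open FirstOrder FirstOrder.Language

/-! ## Relative translations and interpretations -/

namespace FirstOrder.Language

/-- A many-dimensional, parameter-free, one-piece relative translation from `L₁` to `L₂`.
Tuples of variables are indexed by `Fin dim`; the variable `(i, j)` is the `j`-th component of the
`i`-th tuple. Equality is treated as a binary relation symbol, constants as `0`-ary function
symbols. -/
structure RelTranslation (L₁ L₂ : Language.{0, 0}) where
  /-- the length `m` of the tuples -/
  dim : ℕ
  dim_pos : 0 < dim
  /-- the domain formula `δ(x₁, …, x_m)` -/
  dom : L₂.Formula (Fin dim)
  /-- the formula translating equality -/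
  eqv : L₂.Formula (Fin 2 × Fin dim)
  /-- the formula translating a relation symbol -/
  rel : ∀ {n : ℕ}, L₁.Relations n → L₂.Formula (Fin n × Fin dim)
  /-- the formula `ψ_f(x⃗₁, …, x⃗ₙ, y⃗)` translating a function symbol; the tuple `y⃗` is given by the
  variables `Sum.inr j` -/
  fn : ∀ {n : ℕ}, L₁.Functions n → L₂.Formula ((Fin n × Fin dim) ⊕ Fin dim)

namespace RelTranslation

variable {L₁ L₂ : Language.{0, 0}} (τ : RelTranslation L₁ L₂)

/-- `δ(x⃗)` for the tuple of variables `x`. -/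
def domAt {V : Type} (x : Fin τ.dim → V) : L₂.Formula V :=
  τ.dom.relabel x

/-- The translation `(t)^{τ, w⃗}` of a term, a formula saying that the tuple `w⃗` (the variables
`Sum.inr j`) denotes the value of `t`. A variable `x` of `t` becomes the tuple `(x, j)`. -/
noncomputable def term {V : Type} : L₁.Term V → L₂.Formula ((V × Fin τ.dim) ⊕ Fin τ.dim)
  | .var x =>
      Formula.iInf fun j : Fin τ.dim =>
        Term.equal (L := L₂) (Term.var (Sum.inr j)) (Term.var (Sum.inl (x, j)))
  | .func (l := n) f ts =>
      Formula.iExs (Fin n × Fin τ.dim)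
        ((Formula.iInf fun i : Fin n => τ.domAt fun j => Sum.inr (i, j)) ⊓
          (Formula.iInf fun i : Fin n =>
            (term (ts i)).relabel
              (Sum.elim (fun p => Sum.inl (Sum.inl p)) fun j => Sum.inr (i, j))) ⊓
          (τ.fn f).relabel (Sum.elim Sum.inr fun j => Sum.inl (Sum.inr j)))

/-- The translation
`∃ v⃗₁ … v⃗ₙ [⋀ δ(v⃗ᵢ) ∧ ⋀ (tᵢ)^{τ, v⃗ᵢ} ∧ ψ(v⃗₁, …, v⃗ₙ)]` of an atomic formula with arguments
`t₁, …, tₙ`, where `ψ` translates its relation symbol. -/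
noncomputable def atomic {V : Type} {n : ℕ} (ψ : L₂.Formula (Fin n × Fin τ.dim))
    (ts : Fin n → L₁.Term V) : L₂.Formula (V × Fin τ.dim) :=
  Formula.iExs (Fin n × Fin τ.dim)
    ((Formula.iInf fun i : Fin n => τ.domAt fun j => Sum.inr (i, j)) ⊓
      (Formula.iInf fun i : Fin n =>
        (τ.term (ts i)).relabel (Sum.elim Sum.inl fun j => Sum.inr (i, j))) ⊓
      ψ.relabel Sum.inr)

/-- Splits off the tuple of the last (most recently bound) variable. -/
def splitLast {V : Type} {n m : ℕ} :
    (V ⊕ Fin (n + 1)) × Fin m → ((V ⊕ Fin n) × Fin m) ⊕ Fin m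
  | (Sum.inl x, j) => Sum.inl (Sum.inl x, j)
  | (Sum.inr i, j) =>
      Fin.lastCases (motive := fun _ => ((V ⊕ Fin n) × Fin m) ⊕ Fin m)
        (Sum.inr j) (fun i => Sum.inl (Sum.inr i, j)) i

/-- The translation `φ ↦ φ^τ`: it commutes with the propositional connectives, and a quantifier
becomes a block of quantifiers relativized to the domain. -/
noncomputable def formula {V : Type} :
    {n : ℕ} → L₁.BoundedFormula V n → L₂.Formula ((V ⊕ Fin n) × Fin τ.dim)
  | _, .falsum => ⊥
  | _, .equal t₁ t₂ => τ.atomic τ.eqv ![t₁, t₂]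
  | _, .rel R ts => τ.atomic (τ.rel R) ts
  | _, .imp φ ψ => (formula φ).imp (formula ψ)
  | _, .all φ =>
      Formula.iAlls (Fin τ.dim)
        ((τ.domAt Sum.inr).imp ((formula φ).relabel splitLast))

end RelTranslation

/-- The equality axioms of a language: reflexivity, symmetry, transitivity, and congruence for all
function and relation symbols. -/
inductive EqualityAxiom (L : Language.{0, 0}) : L.Sentence → Prop
  | refl : EqualityAxiom L (∀' ((&0 : L.Term (Empty ⊕ Fin 1)) =' &0))
  | symm : EqualityAxiom L
      (∀' ∀' (((&0 : L.Term (Empty ⊕ Fin 2)) =' &1) ⟹ ((&1 : L.Term (Empty ⊕ Fin 2)) =' &0)))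
  | trans : EqualityAxiom L
      (∀' ∀' ∀' (((&0 : L.Term (Empty ⊕ Fin 3)) =' &1) ⟹
        (((&1 : L.Term (Empty ⊕ Fin 3)) =' &2) ⟹ ((&0 : L.Term (Empty ⊕ Fin 3)) =' &2))))
  | fn {n : ℕ} (f : L.Functions n) : EqualityAxiom L
      (Formula.iAlls (α := Empty) (Fin 2 × Fin n)
        ((Formula.iInf fun i : Fin n =>
            Term.equal (L := L) (Term.var (Sum.inr (0, i))) (Term.var (Sum.inr (1, i)))).imp
          (Term.equal (Term.func f fun i => Term.var (Sum.inr (0, i)))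
            (Term.func f fun i => Term.var (Sum.inr (1, i))))))
  | rel {n : ℕ} (R : L.Relations n) : EqualityAxiom L
      (Formula.iAlls (α := Empty) (Fin 2 × Fin n)
        ((Formula.iInf fun i : Fin n =>
            Term.equal (L := L) (Term.var (Sum.inr (0, i))) (Term.var (Sum.inr (1, i)))).imp
          ((R.formula fun i => Term.var (Sum.inr (0, i))).imp
            (R.formula fun i => Term.var (Sum.inr (1, i))))))

/-- `τ` is a relative interpretation of the theory `S` in the theory `T`. Here `T ⊨ᵇ φ` says that
`φ` is a theorem of `T` (true in all nonempty models of `T` under all assignments). The translated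
equality axioms are required throughout; they hold automatically if equality is translated as
equality. -/
structure RelTranslation.Interprets {L₁ L₂ : Language.{0, 0}} (τ : RelTranslation L₁ L₂)
    (S : L₁.Theory) (T : L₂.Theory) : Prop where
  dom_nonempty : T ⊨ᵇ Formula.iExs (α := Empty) (Fin τ.dim) (τ.domAt Sum.inr)
  fn_total : ∀ {n : ℕ} (f : L₁.Functions n),
    T ⊨ᵇ (Formula.iInf fun i : Fin n => τ.domAt fun j => (i, j)).imp
      (Formula.iExsUnique (α := Fin n × Fin τ.dim) (Fin τ.dim) (τ.domAt Sum.inr ⊓ τ.fn f))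
  equality : ∀ φ : L₁.Sentence, EqualityAxiom L₁ φ → T ⊨ᵇ τ.formula φ
  axioms : ∀ φ ∈ S, T ⊨ᵇ τ.formula φ

/-- `S` is (relatively) interpretable in `T`. -/
def Interpretable {L₁ L₂ : Language.{0, 0}} (S : L₁.Theory) (T : L₂.Theory) : Prop :=
  ∃ τ : RelTranslation L₁ L₂, τ.Interprets S T

/-- `S` and `T` are mutually interpretable. -/
def MutuallyInterpretable {L₁ L₂ : Language.{0, 0}} (S : L₁.Theory) (T : L₂.Theory) : Prop :=
  Interpretable S T ∧ Interpretable T S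

end FirstOrder.Language

/-! ## Theories of concatenation -/

namespace Concatenation

/-- The function symbols `0`, `1`, `∘`. -/
inductive Func : ℕ → Type
  | zero : Func 0
  | one : Func 0
  | conc : Func 2

/-- The relation symbol `≼`. -/
inductive Rel : ℕ → Type
  | pref : Rel 2

/-- The language `{0, 1, ∘}`. -/
def LMinus : FirstOrder.Language.{0, 0} := ⟨Func, fun _ => Empty⟩

/-- The language `{0, 1, ∘, ≼}`. -/
def LPref : FirstOrder.Language.{0, 0} := ⟨Func, Rel⟩

/-- A language that contains the symbols `0`, `1`, `∘`. -/
class HasConc (L : FirstOrder.Language.{0, 0}) where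
  sym : ∀ {n : ℕ}, Func n → L.Functions n

instance : HasConc LMinus := ⟨fun f => f⟩

instance : HasConc LPref := ⟨fun f => f⟩

/-- Nonempty binary strings; `false` is the letter `0` and `true` the letter `1`. -/
abbrev BitString : Type := {l : List Bool // l ≠ []}

section Terms

variable {L : FirstOrder.Language.{0, 0}} [HasConc L] {V : Type}

/-- The constant `0` or `1`. -/
def bit (b : Bool) : L.Term V :=
  Term.func (HasConc.sym (if b then Func.one else Func.zero)) ![]

/-- The term `s ∘ t`. -/
def cat (s t : L.Term V) : L.Term V :=
  Term.func (HasConc.sym Func.conc) ![s, t]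

/-- The biteral of a nonempty string, associated to the left: the biteral of `αb` is the biteral of
`α` concatenated with `b`. -/
def biteral (α : BitString) : L.Term V :=
  α.1.tail.foldl (fun t b => cat t (bit b)) (bit (α.1.head α.2))

end Terms

/-- The nonempty prefixes of `α`. -/
abbrev Pref (α : BitString) : Type := {γ : BitString // γ.1 <+: α.1}

/-- The nonempty substrings of `α`. -/
abbrev Sub (α : BitString) : Type := {γ : BitString // γ.1 <:+: α.1}

instance (α : BitString) : Finite (Sub α) :=
  Finite.of_injective (β := {l // l ∈ α.1.sublists})
    (fun γ => ⟨γ.1.1, List.mem_sublists.2 γ.2.sublist⟩)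
    fun _ _ h => Subtype.ext (Subtype.ext (Subtype.mk.inj h))

instance (α : BitString) : Finite (Pref α) :=
  Finite.of_injective (β := Sub α) (fun γ => ⟨γ.1, γ.2.isInfix⟩)
    fun _ _ h => Subtype.ext (Subtype.mk.inj h)

section Axioms

variable (L : FirstOrder.Language.{0, 0}) [HasConc L]

/-- `∀ x y z [(xy)z = x(yz)]` -/
def assoc : L.Sentence :=
  ∀' ∀' ∀' (cat (cat (&0) (&1)) (&2) =' cat (&0) (cat (&1) (&2)))

/-- `∀ x y [x ≠ y → (x0 ≠ y0 ∧ x1 ≠ y1)]` -/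
def rightCancel : L.Sentence :=
  ∀' ∀' (∼((&0) =' (&1)) ⟹
    (∼(cat (&0) (bit false) =' cat (&1) (bit false)) ⊓
      ∼(cat (&0) (bit true) =' cat (&1) (bit true))))

/-- `∀ x y [x0 ≠ y1]` -/
def rightDistinct : L.Sentence :=
  ∀' ∀' ∼(cat (&0) (bit false) =' cat (&1) (bit true))

/-- `∀ x y [x ≠ y → (0x ≠ 0y ∧ 1x ≠ 1y)]` -/
def leftCancel : L.Sentence :=
  ∀' ∀' (∼((&0) =' (&1)) ⟹
    (∼(cat (bit false) (&0) =' cat (bit false) (&1)) ⊓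
      ∼(cat (bit true) (&0) =' cat (bit true) (&1))))

/-- `∀ x y [0x ≠ 1y]` -/
def leftDistinct : L.Sentence :=
  ∀' ∀' ∼(cat (bit false) (&0) =' cat (bit true) (&1))

/-- The three axioms common to both theories. -/
def base : L.Theory := {assoc L, rightCancel L, rightDistinct L}

/-- The two axioms that are added. -/
def leftAxioms : L.Theory := {leftCancel L, leftDistinct L}

end Axioms

/-- `∀ x [x ≼ α ↔ ⋁ {x = γ : γ a nonempty prefix of α}]` -/
noncomputable def prefixAxiom (α : BitString) : LPref.Sentence :=
  ∀' ((Relations.boundedFormula₂ (L := LPref) Rel.pref (&0) (biteral α)).iff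
    (BoundedFormula.iSup fun γ : Pref α => (&0) =' biteral γ.1))

/-- `x ⊑ α`, where `x` is the bound variable `&0`:
`x = α ∨ ∃ u v [α = ux ∨ α = xv ∨ α = uxv]` -/
def substringFormula (α : BitString) : LMinus.BoundedFormula Empty 1 :=
  ((&0) =' biteral α) ⊔
    ∃' ∃' ((biteral α =' cat (&1) (&0)) ⊔ (biteral α =' cat (&0) (&2)) ⊔
      (biteral α =' cat (cat (&1) (&0)) (&2)))

/-- `∀ x [x ⊑ α → ⋁ {x = γ : γ a nonempty substring of α}]` -/
noncomputable def substringAxiom (α : BitString) : LMinus.Sentence :=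
  ∀' (substringFormula α ⟹ BoundedFormula.iSup fun γ : Sub α => (&0) =' biteral γ.1)

/-- The theory `ID`. -/
def ID : LPref.Theory := base LPref ∪ Set.range prefixAxiom

/-- The theory `ID*`. -/
def IDStar : LMinus.Theory := base LMinus ∪ Set.range substringAxiom

/-- The theory `ID` with left cancellation. -/
def IDBar : LPref.Theory := ID ∪ leftAxioms LPref

/-- The theory `ID*` with left cancellation. -/
def IDBarStar : LMinus.Theory := IDStar ∪ leftAxioms LMinus

end Concatenation

/-!
Both interpretations keep `0`, `1`, `∘` and equality. Since the left axioms are universal, they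
pass to every subalgebra, so the same translations serve the extended theories.

In `ID*`, read `x ≼ y` as "`x = y` or `y = xv` for some `v`". If `α = xv` then the substring axioms
make `x` and `v` values of strings, and distinct strings have distinct values by right
cancellation, so `x` is the value of a prefix of `α`.

In `ID`, nothing is known about a factorization of the value of a string into arbitrary elements,
so the domain is cut down to the tame elements `x`: whenever `ux` is regular, `u ≼ ux` holds and
`x` can be stripped letter by letter from the right. Regularity is a list of properties of `≼` that
hold for the values of strings. Because it is a hypothesis on `ux` and not a consequence of
tameness, the tame elements are closed under products. If `ux` is the value of a string `α`, then
`u ≼ ux` makes `u` the value of a prefix of `α`, and stripping `x` in parallel with `α` shows that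
`x` is the value of a suffix of `α`.
-/

section InnerModels

variable {L₁ L₂ : FirstOrder.Language.{0, 0}}

/-- Under `τ`, the tuples in the range of `e` define in `M` a copy of the structure `N`: its
elements are represented by unique tuples, equality is identity, and symbols keep their meaning. -/
structure IsInnerModel (τ : RelTranslation L₁ L₂) {M N : Type*}
    [L₂.Structure M] [L₁.Structure N] (e : N → Fin τ.dim → M) : Prop where
  injective : Function.Injective e
  realize_dom : ∀ x, τ.dom.Realize x ↔ x ∈ Set.range e
  realize_eqv : ∀ a : Fin 2 → N, τ.eqv.Realize (Function.uncurry (e ∘ a)) ↔ a 0 = a 1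
  realize_rel : ∀ {n : ℕ} (R : L₁.Relations n) (a : Fin n → N),
    (τ.rel R).Realize (Function.uncurry (e ∘ a)) ↔ Structure.RelMap R a
  realize_fn : ∀ {n : ℕ} (f : L₁.Functions n) (a : Fin n → N) (b : N),
    (τ.fn f).Realize (Sum.elim (Function.uncurry (e ∘ a)) (e b)) ↔ b = Structure.funMap f a

theorem exists_uncurry_comp_iff {M N ι κ : Type*} (e : N → κ → M) {P : (ι × κ → M) → Prop} :
    (∃ w, (∀ i, (fun j => w (i, j)) ∈ Set.range e) ∧ P w) ↔
      ∃ a : ι → N, P (Function.uncurry (e ∘ a)) := by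
  constructor
  · rintro ⟨w, hw, hP⟩
    choose a ha using hw
    obtain rfl : Function.uncurry (e ∘ a) = w := funext fun p => congrFun (ha p.1) p.2
    exact ⟨a, hP⟩
  · rintro ⟨a, hP⟩
    exact ⟨_, fun i => ⟨a i, rfl⟩, hP⟩

theorem realize_of_equalityAxiom {L : FirstOrder.Language.{0, 0}} {M : Type*} [L.Structure M]
    {φ : L.Sentence} (hφ : EqualityAxiom L φ) : M ⊨ φ := by
  cases hφ with
  | refl => exact fun _ => rfl
  | symm =>
    simp only [Sentence.Realize, Formula.Realize, BoundedFormula.realize_all,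
      BoundedFormula.realize_imp, BoundedFormula.realize_bdEqual]
    exact fun _ _ h => h.symm
  | trans =>
    simp only [Sentence.Realize, Formula.Realize, BoundedFormula.realize_all,
      BoundedFormula.realize_imp, BoundedFormula.realize_bdEqual]
    exact fun _ _ _ h h' => h.trans h'
  | fn f =>
    simp only [Sentence.Realize, Formula.realize_iAlls, Formula.realize_imp, Formula.realize_iInf,
      Formula.realize_equal, Term.realize_var, Term.realize_func, Sum.elim_inr]
    exact fun _ h => congrArg _ (funext h)
  | rel R =>
    simp only [Sentence.Realize, Formula.realize_iAlls, Formula.realize_imp, Formula.realize_iInf,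
      Formula.realize_equal, Term.realize_var, Formula.realize_rel, Sum.elim_inr]
    exact fun _ h hR => funext h ▸ hR

namespace IsInnerModel

variable {τ : RelTranslation L₁ L₂} {M N : Type*}
  [L₂.Structure M] [L₁.Structure N] {e : N → Fin τ.dim → M} (he : IsInnerModel τ e)
include he

theorem realize_domAt {V : Type} (x : Fin τ.dim → V) (v : V → M) :
    (τ.domAt x).Realize v ↔ (fun j => v (x j)) ∈ Set.range e := by
  rw [RelTranslation.domAt, Formula.realize_relabel, he.realize_dom]
  rfl

theorem realize_term {V : Type} (t : L₁.Term V) (v : V → N) (b : N) :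
    (τ.term t).Realize (Sum.elim (Function.uncurry (e ∘ v)) (e b)) ↔ b = t.realize v := by
  induction t generalizing b with
  | var x =>
    simp only [RelTranslation.term, Formula.realize_iInf, Formula.realize_equal, Term.realize_var,
      Sum.elim_inl, Sum.elim_inr, Function.uncurry_apply_pair, Function.comp_apply, ← funext_iff]
    exact he.injective.eq_iff
  | func f ts ih =>
    simp only [RelTranslation.term, Formula.realize_iExs, Formula.realize_inf,
      Formula.realize_iInf, he.realize_domAt, Sum.elim_inr, and_assoc, Formula.realize_relabel,
      exists_uncurry_comp_iff, Sum.comp_elim, Sum.elim_comp_inr]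
    have realize_arg (a : Fin _ → N) (i) := ih i (a i)
    have realize_symbol := he.realize_fn f
    simp only [Function.comp_def, Sum.elim_inl, Sum.elim_inr, Function.uncurry_apply_pair]
      at realize_arg realize_symbol ⊢
    simp only [realize_arg, realize_symbol, ← funext_iff, exists_eq_left, Term.realize_func]

theorem realize_atomic {V : Type} {n : ℕ} (ψ : L₂.Formula (Fin n × Fin τ.dim))
    (ts : Fin n → L₁.Term V) (v : V → N) :
    (τ.atomic ψ ts).Realize (Function.uncurry (e ∘ v)) ↔
      ψ.Realize (Function.uncurry (e ∘ fun i => (ts i).realize v)) := by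
  simp only [RelTranslation.atomic, Formula.realize_iExs, Formula.realize_inf,
    Formula.realize_iInf, he.realize_domAt, Sum.elim_inr, and_assoc, Formula.realize_relabel,
    exists_uncurry_comp_iff, Sum.comp_elim, Sum.elim_comp_inl, Sum.elim_comp_inr]
  have realize_arg (a : Fin n → N) (i) := he.realize_term (ts i) v (a i)
  simp only [Function.comp_def, Sum.elim_inr, Function.uncurry_apply_pair] at realize_arg ⊢
  simp only [realize_arg, ← funext_iff, exists_eq_left]

theorem realize_formula {V : Type} {n : ℕ} (φ : L₁.BoundedFormula V n) (v : V → N)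
    (xs : Fin n → N) :
    (τ.formula φ).Realize (Function.uncurry (e ∘ Sum.elim v xs)) ↔ φ.Realize v xs := by
  induction φ with
  | falsum => rfl
  | equal t₁ t₂ => exact (he.realize_atomic ..).trans (he.realize_eqv _)
  | rel R ts => exact (he.realize_atomic ..).trans (he.realize_rel R _)
  | imp φ ψ ihφ ihψ =>
    rw [RelTranslation.formula, Formula.realize_imp, ihφ, ihψ, BoundedFormula.realize_imp]
  | all φ ih =>
    have split_last (a : N) :
        Sum.elim (Function.uncurry (e ∘ Sum.elim v xs)) (e a) ∘ RelTranslation.splitLast =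
          Function.uncurry (e ∘ Sum.elim v (Fin.snoc xs a : Fin (_ + 1) → N)) := by
      funext ⟨x, j⟩
      rcases x with x | i
      · rfl
      · refine Fin.lastCases ?_ (fun i => ?_) i <;> simp [RelTranslation.splitLast]
    simp only [RelTranslation.formula, Formula.realize_iAlls, Formula.realize_imp,
      he.realize_domAt, Sum.elim_inr, Formula.realize_relabel, BoundedFormula.realize_all,
      Set.forall_mem_range, split_last, ih]

theorem realize_sentence (φ : L₁.Sentence) (v : (Empty ⊕ Fin 0) × Fin τ.dim → M) :
    (τ.formula φ).Realize v ↔ N ⊨ φ := by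
  obtain rfl : v = Function.uncurry (e ∘ Sum.elim default default) :=
    funext fun p => isEmptyElim p.1
  exact he.realize_formula φ default default

end IsInnerModel

theorem interprets_of_isInnerModel {τ : RelTranslation L₁ L₂}
    {S : L₁.Theory} {T : L₂.Theory}
    (h : ∀ M : Theory.ModelType.{0, 0, 0} T, ∃ (N : Theory.ModelType.{0, 0, 0} S)
      (e : N → Fin τ.dim → M), IsInnerModel τ e) :
    τ.Interprets S T where
  dom_nonempty := Theory.models_formula_iff.2 fun M v => by
    obtain ⟨N, e, he⟩ := h M
    obtain ⟨a⟩ := N.nonempty'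
    simp only [Formula.realize_iExs, he.realize_domAt, Sum.elim_inr]
    exact ⟨e a, a, rfl⟩
  fn_total f := Theory.models_formula_iff.2 fun M v => by
    obtain ⟨N, e, he⟩ := h M
    simp only [Formula.realize_imp, Formula.realize_iInf, he.realize_domAt,
      Formula.realize_iExsUnique, Formula.realize_inf, Sum.elim_inr]
    intro hv
    choose a ha using hv
    obtain rfl : Function.uncurry (e ∘ a) = v := funext fun p => congrFun (ha p.1) p.2
    refine ⟨e (Structure.funMap f a), ⟨⟨_, rfl⟩, (he.realize_fn f a _).2 rfl⟩, ?_⟩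
    rintro y ⟨⟨b, hy⟩, hb⟩
    obtain rfl : e b = y := hy
    exact congrArg e ((he.realize_fn f a b).1 hb)
  equality φ hφ := Theory.models_formula_iff.2 fun M v => by
    obtain ⟨N, e, he⟩ := h M
    exact (he.realize_sentence φ v).2 (realize_of_equalityAxiom hφ)
  axioms φ hφ := Theory.models_formula_iff.2 fun M v => by
    obtain ⟨N, e, he⟩ := h M
    exact (he.realize_sentence φ v).2 (N.is_model.realize_of_mem φ hφ)

theorem interprets_and_interprets_union {τ : RelTranslation L₁ L₂}
    {S S' : L₁.Theory} {T T' : L₂.Theory}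
    (h : ∀ M : Theory.ModelType.{0, 0, 0} T, ∃ (N : Theory.ModelType.{0, 0, 0} S)
      (e : N → Fin τ.dim → M), IsInnerModel τ e ∧ (M ⊨ T' → N ⊨ S')) :
    τ.Interprets S T ∧ τ.Interprets (S ∪ S') (T ∪ T') := by
  refine ⟨interprets_of_isInnerModel fun M => ?_, interprets_of_isInnerModel fun M => ?_⟩
  · obtain ⟨N, e, he, -⟩ := h M
    exact ⟨N, e, he⟩
  · have hM : M ⊨ T ∧ M ⊨ T' := Theory.model_union_iff.1 M.is_model
    have := hM.1
    obtain ⟨N, e, he, hN⟩ := h (.of T M)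
    have := hN hM.2
    have : N ⊨ S ∪ S' := Theory.model_union_iff.2 ⟨N.is_model, this⟩
    exact ⟨.of (S ∪ S') N, e, he⟩

/-- The translation that keeps equality, reads each function symbol as one of the other language,
restricts quantifiers to the elements satisfying `dom`, and reads relation symbols as the formulas
`rel`. -/
def absoluteTranslation (onFunction : ∀ {n : ℕ}, L₁.Functions n → L₂.Functions n)
    (dom : L₂.Formula (Fin 1))
    (rel : ∀ {n : ℕ}, L₁.Relations n → L₂.Formula (Fin n × Fin 1)) : RelTranslation L₁ L₂ where
  dim := 1
  dim_pos := one_pos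
  dom := dom
  eqv := Term.equal (Term.var (0, 0)) (Term.var (1, 0))
  rel := rel
  fn f := Term.equal (Term.var (Sum.inr 0))
    (Term.func (onFunction f) fun i => Term.var (Sum.inl (i, 0)))

theorem isInnerModel_absoluteTranslation
    {onFunction : ∀ {n : ℕ}, L₁.Functions n → L₂.Functions n} {dom : L₂.Formula (Fin 1)}
    {rel : ∀ {n : ℕ}, L₁.Relations n → L₂.Formula (Fin n × Fin 1)} {M N : Type*}
    [L₂.Structure M] [L₁.Structure N] {f : N → M} (hf : Function.Injective f)
    (hdom : ∀ x : Fin 1 → M, dom.Realize x ↔ x 0 ∈ Set.range f)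
    (hrel : ∀ {n : ℕ} (R : L₁.Relations n) (a : Fin n → N),
      (rel R).Realize (fun p => f (a p.1)) ↔ Structure.RelMap R a)
    (hfun : ∀ {n : ℕ} (g : L₁.Functions n) (a : Fin n → N),
      f (Structure.funMap g a) = Structure.funMap (onFunction g) (f ∘ a)) :
    IsInnerModel (absoluteTranslation onFunction dom rel) fun x _ => f x where
  injective _ _ h := hf (congrFun h (0 : Fin 1))
  realize_dom x := (hdom x).trans <| exists_congr fun a =>
    ⟨fun h => funext fun j : Fin 1 => Subsingleton.elim 0 j ▸ h, fun h => congrFun h (0 : Fin 1)⟩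
  realize_eqv a := Formula.realize_equal.trans hf.eq_iff
  realize_rel := hrel
  realize_fn g a b := by
    refine Formula.realize_equal.trans (Iff.trans ?_ hf.eq_iff)
    rw [hfun]
    rfl

end InnerModels

namespace Concatenation

namespace BitString

/-- The one-letter string `b`. -/
def letter (b : Bool) : BitString := ⟨[b], List.cons_ne_nil _ _⟩

instance : Append BitString := ⟨fun α β => ⟨α.1 ++ β.1, List.append_ne_nil_of_left_ne_nil α.2 _⟩⟩

@[elab_as_elim]
theorem snoc_induction {P : BitString → Prop} (letter : ∀ b, P (letter b))
    (snoc : ∀ (α : BitString) b, P α → P (α ++ BitString.letter b)) (α : BitString) : P α := by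
  obtain ⟨l, hl⟩ := α
  induction l using List.reverseRecOn with
  | nil => exact absurd rfl hl
  | append_singleton l b ih =>
    rcases eq_or_ne l [] with rfl | hl'
    · exact letter b
    · exact snoc ⟨l, hl'⟩ b (ih hl')

theorem append_letter_append (α β : BitString) (b : Bool) :
    α ++ (β ++ letter b) = α ++ β ++ letter b :=
  Subtype.ext (List.append_assoc ..).symm

theorem eq_or_eq_append_of_prefix {γ α : BitString} (h : γ.1 <+: α.1) :
    γ = α ∨ ∃ δ : BitString, α = γ ++ δ := by
  obtain ⟨l, hl⟩ := h
  rcases eq_or_ne l [] with rfl | hne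
  · exact .inl (Subtype.ext (by simpa using hl))
  · exact .inr ⟨⟨l, hne⟩, Subtype.ext hl.symm⟩

end BitString

section Mul

variable {M N : Type*} [Mul M] [Mul N]

/-- The value of a nonempty string when its letters denote the elements `c b`. As for biterals,
products are associated to the left. -/
def value (c : Bool → M) (α : BitString) : M :=
  α.1.tail.foldl (fun x b => x * c b) (c (α.1.head α.2))

theorem value_letter (c : Bool → M) (b : Bool) : value c (.letter b) = c b := rfl

theorem value_snoc (c : Bool → M) (α : BitString) (b : Bool) :
    value c (α ++ .letter b) = value c α * c b := by
  obtain ⟨_ | ⟨a, l⟩, hl⟩ := α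
  · exact absurd rfl hl
  · exact List.foldl_append ..

theorem map_value (f : N →ₙ* M) (c : Bool → N) (α : BitString) :
    f (value c α) = value (f ∘ c) α :=
  (List.foldl_hom f fun x b => (map_mul f x (c b)).symm).symm

/-- Products with a letter on the right determine both factors: the axioms `x ≠ y → xb ≠ yb` and
`x0 ≠ y1`. -/
def RightFree (c : Bool → M) : Prop := Function.Injective2 fun x b => x * c b

/-- Products with a letter on the left determine both factors: the axioms `x ≠ y → bx ≠ by` and
`0x ≠ 1y`. -/
def LeftFree (c : Bool → M) : Prop := Function.Injective2 fun x b => c b * x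

theorem RightFree.eq_and_eq {c : Bool → M} (hc : RightFree c) {x y : M} {a b : Bool}
    (h : x * c a = y * c b) : x = y ∧ a = b :=
  hc h

theorem RightFree.of_map {f : N →ₙ* M} (hf : Function.Injective f) {c : Bool → N}
    (hc : RightFree (f ∘ c)) : RightFree c := fun x y a b h => by
  have hfxy : f x * f (c a) = f y * f (c b) := by simpa only [map_mul] using congrArg f h
  exact (hc.eq_and_eq hfxy).imp_left fun hxy => hf hxy

theorem LeftFree.of_map {f : N →ₙ* M} (hf : Function.Injective f) {c : Bool → N}
    (hc : LeftFree (f ∘ c)) : LeftFree c := fun x y a b h => by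
  have hfxy : f (c a) * f x = f (c b) * f y := by simpa only [map_mul] using congrArg f h
  obtain ⟨hxy, hab⟩ : f x = f y ∧ a = b := hc hfxy
  exact ⟨hf hxy, hab⟩

/-- `y` is equal to `x` or extends it on the right; this is how `≼` is read in `ID*`. -/
def IsLeftFactor (x y : M) : Prop := x = y ∨ ∃ v, y = x * v

/-- The relation `x ⊑ₛ y`: `y` is equal to `x` or extends it on one or both sides. -/
def IsFactor (x y : M) : Prop := x = y ∨ ∃ u v, y = u * x ∨ y = x * v ∨ y = u * x * v

/-- The fourth axiom scheme of `ID`, for the relation `le` in place of `≼`. -/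
def HasStandardPrefixes (c : Bool → M) (le : M → M → Prop) : Prop :=
  ∀ (α : BitString) (x : M), le x (value c α) ↔ ∃ γ : Pref α, x = value c γ.1

/-- The fourth axiom scheme of `ID*`. -/
def HasStandardFactors (c : Bool → M) : Prop :=
  ∀ (α : BitString) (x : M), IsFactor x (value c α) → ∃ γ : Sub α, x = value c γ.1

/-- The last letter of `x` exists. -/
def EndsInLetter (c : Bool → M) (x : M) : Prop := ∃ b, x = c b ∨ ∃ z, x = z * c b

theorem endsInLetter_letter (c : Bool → M) (b : Bool) : EndsInLetter c (c b) := ⟨b, .inl rfl⟩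

theorem endsInLetter_mul_letter (c : Bool → M) (x : M) (b : Bool) : EndsInLetter c (x * c b) :=
  ⟨b, .inr ⟨x, rfl⟩⟩

theorem endsInLetter_value (c : Bool → M) (α : BitString) : EndsInLetter c (value c α) := by
  induction α using BitString.snoc_induction with
  | letter b => exact endsInLetter_letter c b
  | snoc α b _ => exact value_snoc c α b ▸ endsInLetter_mul_letter c _ b

end Mul

section Semigroup

variable {M : Type*} [Semigroup M] {c : Bool → M}

theorem value_append (c : Bool → M) (α β : BitString) :
    value c (α ++ β) = value c α * value c β := by
  induction β using BitString.snoc_induction with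
  | letter b => exact value_snoc c α b
  | snoc β b ih =>
    rw [BitString.append_letter_append, value_snoc, value_snoc, ih, mul_assoc]

theorem EndsInLetter.mul_left {x : M} (hx : EndsInLetter c x) (u : M) :
    EndsInLetter c (u * x) := by
  obtain ⟨b, rfl | ⟨z, rfl⟩⟩ := hx
  · exact endsInLetter_mul_letter c u b
  · exact mul_assoc u z (c b) ▸ endsInLetter_mul_letter c _ b

namespace RightFree

variable (hc : RightFree c)
include hc

theorem mul_letter_ne_letter {x : M} (hx : EndsInLetter c x) (a b : Bool) : x * c b ≠ c a := by
  intro h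
  obtain rfl : b = a := (hc.eq_and_eq (x := c a * x) (y := c a) (by rw [mul_assoc, h])).2
  have right_one (y : M) : y * x = y := (hc.eq_and_eq (by rw [mul_assoc, h])).1
  obtain ⟨d, hd⟩ := hx
  have mul_ends_in_d (y : M) : ∃ w, y * x = w * c d := by
    rcases hd with rfl | ⟨z, rfl⟩
    · exact ⟨y, rfl⟩
    · exact ⟨y * z, (mul_assoc ..).symm⟩
  obtain ⟨w, hw⟩ := mul_ends_in_d (c d * c !d)
  exact (Bool.eq_not_self d).1 (hc.eq_and_eq (hw.symm.trans (right_one _))).2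

theorem value_snoc_ne_letter (α : BitString) (a b : Bool) :
    value c (α ++ .letter b) ≠ c a := by
  rw [value_snoc]
  exact hc.mul_letter_ne_letter (endsInLetter_value c α) a b

theorem value_injective : Function.Injective (value c) := by
  intro α
  induction α using BitString.snoc_induction with
  | letter a =>
    intro β h
    induction β using BitString.snoc_induction with
    | letter b =>
      obtain rfl : a = b := (hc.eq_and_eq (congrArg (c a * ·) h)).2
      rfl
    | snoc β b _ => exact absurd h.symm (hc.value_snoc_ne_letter β a b)
  | snoc α a ih =>
    intro β h
    induction β using BitString.snoc_induction with
    | letter b => exact absurd h (hc.value_snoc_ne_letter α b a)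
    | snoc β b _ =>
      rw [value_snoc, value_snoc] at h
      obtain ⟨hα, rfl⟩ := hc.eq_and_eq h
      rw [ih hα]

end RightFree

theorem isLeftFactor_value_of_prefix {γ α : BitString} (h : γ.1 <+: α.1) :
    IsLeftFactor (value c γ) (value c α) := by
  rcases BitString.eq_or_eq_append_of_prefix h with rfl | ⟨δ, rfl⟩
  · exact .inl rfl
  · exact .inr ⟨value c δ, value_append c γ δ⟩

theorem HasStandardFactors.hasStandardPrefixes (hfactors : HasStandardFactors c)
    (hc : RightFree c) : HasStandardPrefixes c IsLeftFactor := by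
  refine fun α x => ⟨?_, ?_⟩
  · rintro (rfl | ⟨v, hv⟩)
    · exact ⟨⟨α, List.prefix_rfl⟩, rfl⟩
    · obtain ⟨γ, rfl⟩ := hfactors α x (.inr ⟨v, v, .inr (.inl hv)⟩)
      obtain ⟨δ, rfl⟩ := hfactors α v (.inr ⟨_, v, .inl hv⟩)
      have hα : α = γ.1 ++ δ.1 := hc.value_injective (hv.trans (value_append c γ.1 δ.1).symm)
      exact ⟨⟨γ.1, ⟨δ.1.1, (congrArg Subtype.val hα).symm⟩⟩, rfl⟩
  · rintro ⟨γ, rfl⟩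
    exact isLeftFactor_value_of_prefix γ.2

end Semigroup

section Tame

/-- The elements below `x` can be stripped letter by letter from the right without leaving the
elements below `x`, and `x` is one of them. -/
def Strippable {M : Type*} [Mul M] (c : Bool → M) (le : M → M → Prop) (x : M) : Prop :=
  le x x ∧ ∀ z, le z x → ∃ b, z = c b ∨ ∃ w, le w x ∧ z = w * c b

/-- Properties of the elements below `v` that hold if `v` is the value of a string. -/
structure LocallyRegular {M : Type*} [Mul M] (c : Bool → M) (le : M → M → Prop) (v : M) :
    Prop where
  trans : ∀ {u t}, le u v → le t u → le t v
  le_of_eq_mul_letter : ∀ {u b}, EndsInLetter c u → v = u * c b → le u v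
  strippable_mul : ∀ {u x y}, v = u * x * y → le (u * x) v → Strippable c le x →
    Strippable c le y → Strippable c le (x * y)

/-- The element `y` and all elements below it are locally regular. -/
def Regular {M : Type*} [Mul M] (c : Bool → M) (le : M → M → Prop) (y : M) : Prop :=
  LocallyRegular c le y ∧ ∀ v, le v y → LocallyRegular c le v

/-- The elements that can be split off on the right of any regular element. They form the domain
of the interpretation of `ID*` in `ID`. Regularity of `u * x` is assumed here, rather than proved,
because it is known only for values of strings. -/
def Tame {M : Type*} [Mul M] (c : Bool → M) (le : M → M → Prop) (x : M) : Prop :=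
  EndsInLetter c x ∧
    ∀ u, EndsInLetter c u → Regular c le (u * x) → le u (u * x) ∧ Strippable c le x

variable {M : Type*} [Semigroup M] {c : Bool → M} {le : M → M → Prop}

theorem Regular.of_le {v y : M} (hy : Regular c le y) (h : le v y) : Regular c le v :=
  ⟨hy.2 v h, fun w hw => hy.2 w (hy.1.trans h hw)⟩

theorem Tame.mul {x y : M} (hx : Tame c le x) (hy : Tame c le y) : Tame c le (x * y) := by
  refine ⟨hy.1.mul_left x, fun u hu hreg => ?_⟩
  rw [← mul_assoc] at hreg ⊢
  obtain ⟨hux, hy_strip⟩ := hy.2 _ (hx.1.mul_left u) hreg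
  obtain ⟨hu_le, hx_strip⟩ := hx.2 _ hu (hreg.of_le hux)
  exact ⟨hreg.1.trans hux hu_le, hreg.1.strippable_mul rfl hux hx_strip hy_strip⟩

/-- The domain of the interpretation of `ID*` in `ID`, as a subsemigroup. -/
def tameSubsemigroup (c : Bool → M) (le : M → M → Prop) : Subsemigroup M where
  carrier := {x | Tame c le x}
  mul_mem' := Tame.mul

theorem Strippable.endsInLetter_of_le {x z : M} (hx : Strippable c le x) (hz : le z x) :
    EndsInLetter c z := by
  obtain ⟨b, h | ⟨w, -, h⟩⟩ := hx.2 z hz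
  exacts [⟨b, .inl h⟩, ⟨b, .inr ⟨w, h⟩⟩]

theorem Strippable.exists_suffix_eq_value_of_le (hc : RightFree c) {x : M}
    (hx : Strippable c le x) (α : BitString) {u z : M} (hz : le z x) (h : value c α = u * z) :
    ∃ γ : BitString, γ.1 <:+ α.1 ∧ z = value c γ := by
  induction α using BitString.snoc_induction generalizing z with
  | letter a =>
    rw [value_letter] at h
    obtain ⟨b, rfl | ⟨w, hw, rfl⟩⟩ := hx.2 z hz
    · obtain rfl : a = b := (hc.eq_and_eq (x := c a) (y := c a * u) (by rw [mul_assoc, ← h])).2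
      exact ⟨.letter a, List.suffix_rfl, rfl⟩
    · rw [← mul_assoc] at h
      exact absurd h.symm (hc.mul_letter_ne_letter ((hx.endsInLetter_of_le hw).mul_left u) a b)
  | snoc α a ih =>
    rw [value_snoc] at h
    obtain ⟨b, rfl | ⟨w, hw, rfl⟩⟩ := hx.2 z hz
    · obtain rfl := (hc.eq_and_eq h).2
      exact ⟨.letter a, List.suffix_append _ _, rfl⟩
    · rw [← mul_assoc] at h
      obtain ⟨hα, rfl⟩ := hc.eq_and_eq h
      obtain ⟨γ, ⟨l, hl⟩, rfl⟩ := ih hw hα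
      refine ⟨γ ++ .letter a, ⟨l, ?_⟩, (value_snoc c γ a).symm⟩
      exact (List.append_assoc ..).symm.trans (congrArg (· ++ [a]) hl)

namespace HasStandardPrefixes

variable (hle : HasStandardPrefixes c le)
include hle

theorem le_value_of_prefix {γ α : BitString} (h : γ.1 <+: α.1) : le (value c γ) (value c α) :=
  (hle α _).2 ⟨⟨γ, h⟩, rfl⟩

theorem strippable_value (α : BitString) : Strippable c le (value c α) := by
  refine ⟨hle.le_value_of_prefix List.prefix_rfl, fun z hz => ?_⟩
  obtain ⟨⟨γ, hγ⟩, rfl⟩ := (hle α z).1 hz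
  induction γ using BitString.snoc_induction with
  | letter b => exact ⟨b, .inl rfl⟩
  | snoc γ b _ =>
    have hγα : γ.1 <+: α.1 := (List.prefix_append _ _).trans hγ
    exact ⟨b, .inr ⟨value c γ, hle.le_value_of_prefix hγα, value_snoc c γ b⟩⟩

theorem tame_letter (b : Bool) : Tame c le (c b) :=
  ⟨endsInLetter_letter c b, fun _ hu hreg =>
    ⟨hreg.1.le_of_eq_mul_letter hu rfl, hle.strippable_value (.letter b)⟩⟩

/-- The letters, as elements of the domain of the interpretation of `ID*` in `ID`. -/
def tameLetter (b : Bool) : tameSubsemigroup c le := ⟨c b, hle.tame_letter b⟩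

theorem coe_value_tameLetter (α : BitString) :
    ((value hle.tameLetter α : tameSubsemigroup c le) : M) = value c α :=
  map_value (MulMemClass.subtype (tameSubsemigroup c le)) hle.tameLetter α

variable (hc : RightFree c)
include hc

theorem locallyRegular_value (α : BitString) : LocallyRegular c le (value c α) where
  trans {u t} hu ht := by
    obtain ⟨γ, rfl⟩ := (hle α u).1 hu
    obtain ⟨δ, rfl⟩ := (hle γ.1 t).1 ht
    exact hle.le_value_of_prefix (δ.2.trans γ.2)
  le_of_eq_mul_letter {u b} hu h := by
    induction α using BitString.snoc_induction with
    | letter a => exact absurd h.symm (hc.mul_letter_ne_letter hu a b)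
    | snoc α a _ =>
      obtain ⟨rfl, rfl⟩ := hc.eq_and_eq ((value_snoc c α a).symm.trans h)
      exact hle.le_value_of_prefix (List.prefix_append _ _)
  strippable_mul {u x y} h hux hx hy := by
    obtain ⟨γ, hγ⟩ := (hle α _).1 hux
    obtain ⟨δ, -, rfl⟩ := hx.exists_suffix_eq_value_of_le hc γ.1 hx.1 hγ.symm
    obtain ⟨ε, -, rfl⟩ := hy.exists_suffix_eq_value_of_le hc α hy.1 h
    exact value_append c δ ε ▸ hle.strippable_value (δ ++ ε)

theorem regular_value (α : BitString) : Regular c le (value c α) := by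
  refine ⟨hle.locallyRegular_value hc α, fun v hv => ?_⟩
  obtain ⟨γ, rfl⟩ := (hle α v).1 hv
  exact hle.locallyRegular_value hc γ.1

theorem exists_prefix_eq_left_of_tame {u x : M} (hu : Tame c le u) (hx : Tame c le x)
    {α : BitString} (h : value c α = u * x) : ∃ γ : Pref α, u = value c γ.1 :=
  (hle α u).1 (h ▸ (hx.2 u hu.1 (h ▸ hle.regular_value hc α)).1)

theorem exists_suffix_eq_right_of_tame {u x : M} (hu : Tame c le u) (hx : Tame c le x)
    {α : BitString} (h : value c α = u * x) : ∃ γ : BitString, γ.1 <:+ α.1 ∧ x = value c γ :=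
  have hx_strip : Strippable c le x := (hx.2 u hu.1 (h ▸ hle.regular_value hc α)).2
  hx_strip.exists_suffix_eq_value_of_le hc α hx_strip.1 h

theorem hasStandardFactors_tameLetter : HasStandardFactors hle.tameLetter := by
  intro α x hx
  suffices ∃ γ : Sub α, (x : M) = value c γ.1 from
    this.imp fun γ hγ => Subtype.ext (hγ.trans (hle.coe_value_tameLetter γ.1).symm)
  rcases hx with rfl | ⟨u, v, h | h | h⟩
  · exact ⟨⟨α, List.infix_rfl⟩, hle.coe_value_tameLetter α⟩
  all_goals replace h := (hle.coe_value_tameLetter α).symm.trans (congrArg Subtype.val h)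
  · obtain ⟨γ, hγ, hx⟩ := hle.exists_suffix_eq_right_of_tame hc u.2 x.2 h
    exact ⟨⟨γ, hγ.isInfix⟩, hx⟩
  · obtain ⟨γ, hx⟩ := hle.exists_prefix_eq_left_of_tame hc x.2 v.2 h
    exact ⟨⟨γ.1, γ.2.isInfix⟩, hx⟩
  · obtain ⟨γ, hux⟩ := hle.exists_prefix_eq_left_of_tame hc (u * x).2 v.2 h
    obtain ⟨δ, hδ, hx⟩ := hle.exists_suffix_eq_right_of_tame hc u.2 x.2 hux.symm
    exact ⟨⟨δ, hδ.isInfix.trans γ.2.isInfix⟩, hx⟩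

end HasStandardPrefixes

end Tame

section Semantics

/-- The operation denoted by a function symbol when `∘` denotes multiplication and the letters
denote the elements `c b`. -/
def evalFunc {M : Type*} [Mul M] (c : Bool → M) : ∀ {n : ℕ}, Func n → (Fin n → M) → M
  | _, .zero, _ => c false
  | _, .one, _ => c true
  | _, .conc, a => a 0 * a 1

/-- The symbols `0`, `1`, `∘` of `L` denote the elements `c b` and multiplication. -/
structure Compatible (L : FirstOrder.Language.{0, 0}) [HasConc L] {M : Type*} [L.Structure M]
    [Mul M] (c : Bool → M) : Prop where
  funMap_sym : ∀ {n : ℕ} (f : Func n) (a : Fin n → M),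
    Structure.funMap (HasConc.sym f : L.Functions n) a = evalFunc c f a

/-- The relation denoted by `≼`. -/
def prefixRel (M : Type*) [LPref.Structure M] (x y : M) : Prop :=
  Structure.RelMap (L := LPref) Rel.pref ![x, y]

/-- The `LMinus`-structure given by `c` and multiplication. -/
abbrev concStructure {M : Type*} [Mul M] (c : Bool → M) : LMinus.Structure M where
  funMap := evalFunc c
  RelMap := Empty.elim

/-- The `LPref`-structure given by `c`, multiplication, and the relation `le`. -/
abbrev prefStructure {M : Type*} [Mul M] (c : Bool → M) (le : M → M → Prop) :
    LPref.Structure M where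
  funMap := evalFunc c
  RelMap
    | .pref, a => le (a 0) (a 1)

theorem injective2_iff_ne_false_true {α β : Type*} {f : α → Bool → β} :
    Function.Injective2 f ↔
      (∀ x y, x ≠ y → f x false ≠ f y false ∧ f x true ≠ f y true) ∧
        ∀ x y, f x false ≠ f y true := by
  refine ⟨fun hf => ⟨fun x y hxy => ⟨fun h => hxy (hf h).1, fun h => hxy (hf h).1⟩,
    fun x y h => Bool.false_ne_true (hf h).2⟩, ?_⟩
  rintro ⟨cancel, distinct⟩ x y a b h
  obtain rfl : a = b := by
    cases a <;> cases b
    exacts [rfl, absurd h (distinct x y), absurd h.symm (distinct y x), rfl]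
  refine ⟨of_not_not fun hxy => ?_, rfl⟩
  cases a
  exacts [(cancel x y hxy).1 h, (cancel x y hxy).2 h]

namespace Compatible

section Mul

variable {L : FirstOrder.Language.{0, 0}} [HasConc L] {M : Type*} [L.Structure M] [Mul M]
  {c : Bool → M} (h : Compatible L c)
include h

theorem map_funMap_sym {L' : FirstOrder.Language.{0, 0}} [HasConc L'] {N : Type*}
    [L'.Structure N] [Mul N] {c' : Bool → N} (h' : Compatible L' c') {f : N →ₙ* M}
    (hf : ∀ b, f (c' b) = c b) {n : ℕ} (g : Func n) (a : Fin n → N) :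
    f (Structure.funMap (HasConc.sym g : L'.Functions n) a) =
      Structure.funMap (HasConc.sym g : L.Functions n) (f ∘ a) := by
  rw [h.funMap_sym, h'.funMap_sym]
  cases g
  exacts [hf false, hf true, map_mul f _ _]

variable {V : Type}

theorem realize_bit (b : Bool) (v : V → M) : (bit b : L.Term V).realize v = c b := by
  cases b
  exacts [h.funMap_sym .zero _, h.funMap_sym .one _]

theorem realize_cat (s t : L.Term V) (v : V → M) :
    (cat s t).realize v = s.realize v * t.realize v :=
  h.funMap_sym .conc _

theorem realize_biteral (α : BitString) (v : V → M) :
    (biteral α : L.Term V).realize v = value c α := by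
  have realize_cat_bit (t : L.Term V) (b : Bool) :
      t.realize v * c b = (cat t (bit b)).realize v := by
    rw [h.realize_cat, h.realize_bit]
  rw [value, ← h.realize_bit (α.1.head α.2) v]
  exact (List.foldl_hom (Term.realize v) realize_cat_bit).symm

theorem realize_assoc : M ⊨ assoc L ↔ ∀ x y z : M, x * y * z = x * (y * z) := by
  simp only [assoc, Sentence.Realize, Formula.Realize, BoundedFormula.realize_all,
    BoundedFormula.realize_bdEqual, h.realize_cat]
  rfl

theorem realize_right_iff : (M ⊨ rightCancel L ∧ M ⊨ rightDistinct L) ↔ RightFree c := by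
  rw [RightFree, injective2_iff_ne_false_true]
  simp only [rightCancel, rightDistinct, Sentence.Realize, Formula.Realize,
    BoundedFormula.realize_all, BoundedFormula.realize_bdEqual, BoundedFormula.realize_imp,
    BoundedFormula.realize_not, BoundedFormula.realize_inf, h.realize_cat, h.realize_bit]
  rfl

theorem model_base_iff :
    M ⊨ base L ↔ (∀ x y z : M, x * y * z = x * (y * z)) ∧ RightFree c := by
  rw [base, Theory.model_insert_iff, Theory.model_insert_iff, Theory.model_singleton_iff,
    h.realize_assoc, h.realize_right_iff]

theorem model_leftAxioms_iff : M ⊨ leftAxioms L ↔ LeftFree c := by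
  rw [leftAxioms, Theory.model_insert_iff, Theory.model_singleton_iff, LeftFree,
    injective2_iff_ne_false_true]
  simp only [leftCancel, leftDistinct, Sentence.Realize, Formula.Realize,
    BoundedFormula.realize_all, BoundedFormula.realize_bdEqual, BoundedFormula.realize_imp,
    BoundedFormula.realize_not, BoundedFormula.realize_inf, h.realize_cat, h.realize_bit]
  rfl

end Mul

theorem realize_prefixAxiom {M : Type*} [LPref.Structure M] [Mul M] {c : Bool → M}
    (h : Compatible LPref c) (α : BitString) :
    M ⊨ prefixAxiom α ↔
      ∀ x, prefixRel M x (value c α) ↔ ∃ γ : Pref α, x = value c γ.1 := by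
  simp only [prefixAxiom, Sentence.Realize, Formula.Realize, BoundedFormula.realize_all,
    BoundedFormula.realize_iff, BoundedFormula.realize_iSup,
    BoundedFormula.realize_rel₂ (L := LPref) (R := Rel.pref), BoundedFormula.realize_bdEqual,
    h.realize_biteral]
  rfl

theorem realize_substringAxiom {M : Type*} [LMinus.Structure M] [Mul M] {c : Bool → M}
    (h : Compatible LMinus c) (α : BitString) :
    M ⊨ substringAxiom α ↔
      ∀ x, IsFactor x (value c α) → ∃ γ : Sub α, x = value c γ.1 := by
  simp only [substringAxiom, substringFormula, Sentence.Realize, Formula.Realize,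
    BoundedFormula.realize_all, BoundedFormula.realize_imp, BoundedFormula.realize_sup,
    BoundedFormula.realize_ex, BoundedFormula.realize_iSup, BoundedFormula.realize_bdEqual,
    h.realize_biteral, h.realize_cat, or_assoc]
  rfl

theorem model_ID_iff {M : Type*} [LPref.Structure M] [Semigroup M] {c : Bool → M}
    (h : Compatible LPref c) :
    M ⊨ ID ↔ RightFree c ∧ HasStandardPrefixes c (prefixRel M) := by
  rw [ID, Theory.model_union_iff, h.model_base_iff, and_iff_right mul_assoc, Theory.model_iff,
    Set.forall_mem_range]
  exact and_congr_right' (forall_congr' h.realize_prefixAxiom)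

theorem model_IDStar_iff {M : Type*} [LMinus.Structure M] [Semigroup M] {c : Bool → M}
    (h : Compatible LMinus c) :
    M ⊨ IDStar ↔ RightFree c ∧ HasStandardFactors c := by
  rw [IDStar, Theory.model_union_iff, h.model_base_iff, and_iff_right mul_assoc, Theory.model_iff,
    Set.forall_mem_range]
  exact and_congr_right' (forall_congr' h.realize_substringAxiom)

end Compatible

theorem exists_semigroup_compatible {L : FirstOrder.Language.{0, 0}} [HasConc L] {M : Type*}
    [L.Structure M] (hM : M ⊨ base L) :
    ∃ (_ : Semigroup M) (c : Bool → M), Compatible L c := by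
  let _ : Mul M := ⟨fun x y => Structure.funMap (HasConc.sym Func.conc : L.Functions 2) ![x, y]⟩
  let c (b : Bool) : M := (bit b : L.Term Empty).realize Empty.elim
  have h : Compatible L c := ⟨fun f a => by
    cases f
    exacts [congrArg _ (Subsingleton.elim _ _), congrArg _ (Subsingleton.elim _ _),
      congrArg _ (FinVec.etaExpand_eq a).symm]⟩
  exact ⟨{ mul_assoc := (h.model_base_iff.1 hM).1 }, c, ⟨h.funMap_sym⟩⟩

end Semantics

section Formulas

section Quantifiers

variable {L : FirstOrder.Language.{0, 0}} {V : Type} {n : ℕ}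

/-- The term `t`, read in a context with `n` further variables. -/
def weaken (t : L.Term V) : L.Term (V ⊕ Fin n) := t.relabel Sum.inl

variable {M : Type*} [L.Structure M] (v : V → M)

theorem realize_weaken (t : L.Term V) (x : Fin n → M) :
    (weaken t).realize (Sum.elim v x) = t.realize v := by
  rw [weaken, Term.realize_relabel, Sum.elim_comp_inl]

theorem realize_bound (i : Fin n) (x : Fin n → M) :
    (&i : L.Term (V ⊕ Fin n)).realize (Sum.elim v x) = x i := rfl

theorem realize_iAlls_fin (φ : L.Formula (V ⊕ Fin n)) :
    (φ.iAlls (Fin n)).Realize v ↔ FinVec.Forall fun x => φ.Realize (Sum.elim v x) :=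
  Formula.realize_iAlls.trans (FinVec.forall_iff _).symm

theorem realize_iExs_fin (φ : L.Formula (V ⊕ Fin n)) :
    (φ.iExs (Fin n)).Realize v ↔ FinVec.Exists fun x => φ.Realize (Sum.elim v x) :=
  Formula.realize_iExs.trans (FinVec.exists_iff _).symm

end Quantifiers

variable {V : Type}

/-- The formula `s ≼ t`. -/
def prefixFormula (s t : LPref.Term V) : LPref.Formula V :=
  Relations.formula₂ (L := LPref) Rel.pref s t

/-- The formula expressing `EndsInLetter`. -/
noncomputable def endsInLetterFormula (t : LPref.Term V) : LPref.Formula V :=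
  Formula.iSup fun b : Bool =>
    Term.equal t (bit b) ⊔ Formula.iExs (Fin 1) (Term.equal (weaken t) (cat (&0) (bit b)))

/-- The formula expressing `Strippable`. -/
noncomputable def strippableFormula (t : LPref.Term V) : LPref.Formula V :=
  prefixFormula t t ⊓ Formula.iAlls (Fin 1) (prefixFormula (&0) (weaken t) ⟹
    Formula.iSup fun b : Bool => Term.equal (&0) (bit b) ⊔
      Formula.iExs (Fin 1) (prefixFormula (&0) (weaken (weaken t)) ⊓
        Term.equal (weaken (&0)) (cat (&0) (bit b))))

/-- The formula expressing `LocallyRegular`. -/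
noncomputable def locallyRegularFormula (t : LPref.Term V) : LPref.Formula V :=
  Formula.iAlls (Fin 2)
    (prefixFormula (&0) (weaken t) ⟹ prefixFormula (&1) (&0) ⟹ prefixFormula (&1) (weaken t)) ⊓
  (Formula.iAlls (Fin 1)
    (Formula.iInf fun b : Bool => endsInLetterFormula (&0) ⟹
      Term.equal (weaken t) (cat (&0) (bit b)) ⟹ prefixFormula (&0) (weaken t)) ⊓
  Formula.iAlls (Fin 3)
    (Term.equal (weaken t) (cat (cat (&0) (&1)) (&2)) ⟹
      prefixFormula (cat (&0) (&1)) (weaken t) ⟹ strippableFormula (&1) ⟹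
        strippableFormula (&2) ⟹ strippableFormula (cat (&1) (&2))))

/-- The formula expressing `Regular`. -/
noncomputable def regularFormula (t : LPref.Term V) : LPref.Formula V :=
  locallyRegularFormula t ⊓
    Formula.iAlls (Fin 1) (prefixFormula (&0) (weaken t) ⟹ locallyRegularFormula (&0))

/-- The formula expressing `Tame`. -/
noncomputable def tameFormula (t : LPref.Term V) : LPref.Formula V :=
  endsInLetterFormula t ⊓ Formula.iAlls (Fin 1)
    (endsInLetterFormula (&0) ⟹ regularFormula (cat (&0) (weaken t)) ⟹
      prefixFormula (&0) (cat (&0) (weaken t)) ⊓ strippableFormula (weaken t))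

/-- The formula expressing `IsLeftFactor`. -/
noncomputable def leftFactorFormula (s t : LMinus.Term V) : LMinus.Formula V :=
  Term.equal s t ⊔ Formula.iExs (Fin 1) (Term.equal (weaken t) (cat (weaken s) (&0)))

theorem realize_prefixFormula {M : Type*} [LPref.Structure M] (s t : LPref.Term V) (v : V → M) :
    (prefixFormula s t).Realize v ↔ prefixRel M (s.realize v) (t.realize v) :=
  Formula.realize_rel₂

namespace Compatible

section Prefix

variable {M : Type*} [LPref.Structure M] [Mul M] {c : Bool → M} (h : Compatible LPref c)
  (t : LPref.Term V) (v : V → M)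
include h

theorem realize_endsInLetterFormula :
    (endsInLetterFormula t).Realize v ↔ EndsInLetter c (t.realize v) := by
  simp only [endsInLetterFormula, Formula.realize_iSup, Formula.realize_sup, Formula.realize_equal,
    realize_iExs_fin, FinVec.Exists, h.realize_cat, h.realize_bit, realize_weaken, realize_bound,
    Matrix.cons_val, EndsInLetter]

theorem realize_strippableFormula :
    (strippableFormula t).Realize v ↔ Strippable c (prefixRel M) (t.realize v) := by
  simp only [strippableFormula, Formula.realize_iSup, Formula.realize_sup, Formula.realize_inf,
    Formula.realize_imp, Formula.realize_equal, realize_iAlls_fin, FinVec.Forall, realize_iExs_fin,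
    FinVec.Exists, realize_prefixFormula, h.realize_cat, h.realize_bit, realize_weaken,
    realize_bound, Matrix.cons_val, Strippable]

theorem realize_locallyRegularFormula :
    (locallyRegularFormula t).Realize v ↔ LocallyRegular c (prefixRel M) (t.realize v) := by
  simp only [locallyRegularFormula, Formula.realize_iInf, Formula.realize_inf, Formula.realize_imp,
    Formula.realize_equal, realize_iAlls_fin, FinVec.Forall, realize_prefixFormula,
    h.realize_endsInLetterFormula, h.realize_strippableFormula, h.realize_cat, h.realize_bit,
    realize_weaken, realize_bound, Matrix.cons_val]
  exact ⟨fun ⟨h₁, h₂, h₃⟩ => ⟨h₁ _ _, h₂ _ _, h₃ _ _ _⟩, fun hv =>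
    ⟨fun _ _ => hv.trans, fun _ _ => hv.le_of_eq_mul_letter, fun _ _ _ => hv.strippable_mul⟩⟩

theorem realize_regularFormula :
    (regularFormula t).Realize v ↔ Regular c (prefixRel M) (t.realize v) := by
  simp only [regularFormula, Formula.realize_inf, Formula.realize_imp, realize_iAlls_fin,
    FinVec.Forall, realize_prefixFormula, h.realize_locallyRegularFormula, realize_weaken,
    realize_bound, Matrix.cons_val, Regular]

theorem realize_tameFormula :
    (tameFormula t).Realize v ↔ Tame c (prefixRel M) (t.realize v) := by
  simp only [tameFormula, Formula.realize_inf, Formula.realize_imp, realize_iAlls_fin,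
    FinVec.Forall, realize_prefixFormula, h.realize_endsInLetterFormula,
    h.realize_strippableFormula, h.realize_regularFormula, h.realize_cat, realize_weaken,
    realize_bound, Matrix.cons_val, Tame]

end Prefix

theorem realize_leftFactorFormula {M : Type*} [LMinus.Structure M] [Mul M] {c : Bool → M}
    (h : Compatible LMinus c) (s t : LMinus.Term V) (v : V → M) :
    (leftFactorFormula s t).Realize v ↔ IsLeftFactor (s.realize v) (t.realize v) := by
  simp only [leftFactorFormula, Formula.realize_sup, Formula.realize_equal, realize_iExs_fin,
    FinVec.Exists, h.realize_cat, realize_weaken, realize_bound, Matrix.cons_val, IsLeftFactor]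

end Compatible

end Formulas

section Translations

/-- The translation of `ID*` into `ID`: quantifiers are restricted to the tame elements. -/
noncomputable def tameTranslation : RelTranslation LMinus LPref :=
  absoluteTranslation (fun f => HasConc.sym f) (tameFormula (Term.var 0)) Empty.elim

/-- The translation of `ID` into `ID*`: `≼` is read as the formula expressing `IsLeftFactor`. -/
noncomputable def leftFactorTranslation : RelTranslation LPref LMinus :=
  absoluteTranslation (fun f => HasConc.sym f) ⊤ fun
    | Rel.pref => leftFactorFormula (Term.var (0, 0)) (Term.var (1, 0))

theorem tameTranslation_interprets :
    tameTranslation.Interprets IDStar ID ∧ tameTranslation.Interprets IDBarStar IDBar := by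
  refine interprets_and_interprets_union fun M => ?_
  obtain ⟨_, c, hM⟩ := exists_semigroup_compatible (Theory.model_union_iff.1 M.is_model).1
  obtain ⟨hc, hle⟩ := hM.model_ID_iff.1 M.is_model
  let N := tameSubsemigroup c (prefixRel M)
  let incl : N →ₙ* M := MulMemClass.subtype N
  have incl_injective : Function.Injective incl := Subtype.val_injective
  let _ : LMinus.Structure N := concStructure hle.tameLetter
  have hN : Compatible LMinus hle.tameLetter := ⟨fun _ _ => rfl⟩
  have : N ⊨ IDStar := hN.model_IDStar_iff.2
    ⟨.of_map (f := incl) incl_injective hc, hle.hasStandardFactors_tameLetter hc⟩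
  have : Nonempty N := ⟨hle.tameLetter false⟩
  refine ⟨.of IDStar N, fun x _ => incl x, ?_, fun hleft => ?_⟩
  · refine isInnerModel_absoluteTranslation incl_injective (fun x => ?_) (fun R => R.elim)
      (hM.map_funMap_sym hN fun _ => rfl)
    exact (hM.realize_tameFormula _ x).trans
      (Set.ext_iff.1 (Subtype.range_val (s := (N : Set M))) (x 0)).symm
  · exact hN.model_leftAxioms_iff.2
      (.of_map (f := incl) incl_injective (hM.model_leftAxioms_iff.1 hleft))

theorem leftFactorTranslation_interprets :
    leftFactorTranslation.Interprets ID IDStar ∧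
      leftFactorTranslation.Interprets IDBar IDBarStar := by
  refine interprets_and_interprets_union fun M => ?_
  obtain ⟨_, c, hM⟩ := exists_semigroup_compatible (Theory.model_union_iff.1 M.is_model).1
  obtain ⟨hc, hfactors⟩ := hM.model_IDStar_iff.1 M.is_model
  let _ : LPref.Structure M := prefStructure c IsLeftFactor
  have hN : Compatible LPref c := ⟨fun _ _ => rfl⟩
  have : M ⊨ ID := hN.model_ID_iff.2 ⟨hc, hfactors.hasStandardPrefixes hc⟩
  refine ⟨.of ID M, fun x _ => x, ?_, fun hleft => ?_⟩
  · refine isInnerModel_absoluteTranslation Function.injective_id (fun x => ?_) (fun R a => ?_)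
      (hM.map_funMap_sym hN (f := .id M) fun _ => rfl)
    · exact iff_of_true (Formula.realize_top.2 trivial) ⟨x 0, rfl⟩
    · cases R
      exact hM.realize_leftFactorFormula _ _ _
  · exact hN.model_leftAxioms_iff.2 (hM.model_leftAxioms_iff.1 hleft)

end Translations

end Concatenation

theorem mainTheorem3 :
    MutuallyInterpretable Concatenation.IDBar Concatenation.IDBarStar ∧
    (∃ τ : RelTranslation Concatenation.LMinus Concatenation.LPref,
      τ.Interprets Concatenation.IDStar Concatenation.ID ∧
      τ.Interprets Concatenation.IDBarStar Concatenation.IDBar) ∧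
    (∃ σ : RelTranslation Concatenation.LPref Concatenation.LMinus,
      σ.Interprets Concatenation.ID Concatenation.IDStar ∧
      σ.Interprets Concatenation.IDBar Concatenation.IDBarStar) := by
  have tame := Concatenation.tameTranslation_interprets
  have leftFactor := Concatenation.leftFactorTranslation_interprets
  exact ⟨⟨⟨_, leftFactor.2⟩, ⟨_, tame.2⟩⟩, ⟨_, tame⟩, ⟨_, leftFactor⟩⟩
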